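/- Let $R$ be a commutative Noetherian local ring. A finite (i.e. finitely generated) $R$-module $C$ is *semidualizing* if the homothety map $R\to\mathrm{Hom}_R(C,C)$ is an isomorphism and $\mathrm{Ext}^{k}_R(C,C)=0$ for all $k\ge 1$. Let $\mathfrak{G}_0(R)$ be the set of isomorphism classes $[C]$ of semidualizing $R$-modules. For $C$ semidualizing, a finite $R$-module $M$ is *totally $C$-reflexive* if the biduality map $M\to\mathrm{Hom}_R(\mathrm{Hom}_R(M,C),C)$ is an isomorphism and $\mathrm{Ext}^{k}_R(M,C)=0=\mathrm{Ext}^{k}_R(\mathrm{Hom}_R(M,C),C)$ for all $k\ge 1$. Write $[C]\trianglelefteq[B]$ if $B$ is totally $C$-reflexive, and $[C]\vartriangleleft[B]$ if moreover $[C]\ne[B]$. A chain $[C_n]\vartriangleleft\cdots\vartriangleleft[C_1]\vartriangleleft[C_0]$ in $\mathfrak{G}_0(R)$ has *length* $n$ if $[C_i]\neq[C_j]$ whenever $i\ne j$. For a chain of length $n$ in $\mathfrak{G}_0(R)$ and a sequence $\mathbf{i}=\{i_1,\dots,i_j\}$ of integers with $j\ge 0$ and $1\le i_1<\cdots<i_j\le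 n$, put $C_{\mathbf{i}}=C_0^{\dagger_{C_{i_1}}\dagger_{C_{i_2}}\cdots\dagger_{C_{i_j}}}$, where $(-)^{\dagger_{C}}=\mathrm{Hom}_R(-,C)$ and $C_\emptyset=C_0$. The chain is *suitable* if $C_0\cong R$ and $C_{\mathbf{i}}$ is totally $C_t$-reflexive for all $\mathbf{i}$ and all $0\le t\le n$ with $i_j\le t$ (no lower bound on $t$ when $\mathbf{i}=\emptyset$). **Proposition.** Let $\mathbf{x}=x_1,\dots,x_d$ be an $R$-regular sequence and let $[C_n]\vartriangleleft\cdots\vartriangleleft[C_1]\vartriangleleft[C_0]$ be a suitable chain in $\mathfrak{G}_0(R)$ of length $n$. Put $\overline{R}=R/\mathbf{x}R$ and $\overline{C}_i=\overline{R}\otimes_R C_i$ for $i=0,1,\dots,n$. Then $[\overline{C}_n]\vartriangleleft\cdots\vartriangleleft[\overline{C}_1]\vartriangleleft[\overline{C}_0]$ is a suitable chain in $\mathfrak{G}_0(\overline{R})$ of length $n$. Moreover, for every sequence $\mathbf{i}=\{i_1,\dots,i_j\}$ with $j\ge0$ and $1\le i_1<\cdots<i_j\le n$, there is an isomorphism of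 $\overline{R}$-modules $$\overline{C}_0^{\,\overline{\dagger}_{\overline{C}_{i_1}}\overline{\dagger}_{\overline{C}_{i_2}}\cdots\overline{\dagger}_{\overline{C}_{i_j}}}\;\cong\;\overline{R}\otimes_R C_{\mathbf{i}},$$ where $(-)^{\overline{\dagger}_{C}}=\mathrm{Hom}_{\overline{R}}(-,C)$. -/

import Mathlib

open CategoryTheory
open scoped TensorProduct

universe u

/-- `Ext^k_R(M, N) = 0` for all `k ≥ 1`. -/
def ExtVanishes (R : Type u) [CommRing R] (M N : Type u) [AddCommGroup M] [Module R M]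
    [AddCommGroup N] [Module R N] : Prop :=
  ∀ k : ℕ, 1 ≤ k → Subsingleton (Abelian.Ext (ModuleCat.of R M) (ModuleCat.of R N) k)

/-- A finite `R`-module `C` is semidualizing if the homothety map `R → Hom_R(C, C)`,
`r ↦ (c ↦ r c)`, is an isomorphism and `Ext^{≥ 1}_R(C, C) = 0`. -/
structure IsSemidualizing (R : Type u) [CommRing R] (C : Type u) [AddCommGroup C] [Module R C] :
    Prop where
  finite : Module.Finite R C
  homothety : Function.Bijective (LinearMap.lsmul R C)
  ext_self : ExtVanishes R C C

/-- A finite `R`-module `M` is totally `C`-reflexive if the biduality map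
`M → Hom_R(Hom_R(M, C), C)`, `m ↦ (f ↦ f m)`, is an isomorphism and
`Ext^{≥ 1}_R(M, C) = 0 = Ext^{≥ 1}_R(Hom_R(M, C), C)`. -/
structure IsTotallyReflexive (R : Type u) [CommRing R] (C : Type u) [AddCommGroup C] [Module R C]
    (M : Type u) [AddCommGroup M] [Module R M] : Prop where
  finite : Module.Finite R M
  biduality : Function.Bijective
    (LinearMap.applyₗ : M →ₗ[R] (M →ₗ[R] C) →ₗ[R] C)
  ext : ExtVanishes R M C
  ext_dual : ExtVanishes R (M →ₗ[R] C) C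

/-- The modules `C 0, …, C n` represent a chain `[C n] ◁ ⋯ ◁ [C 1] ◁ [C 0]` of length `n` in the
set of isomorphism classes of semidualizing `R`-modules: each `C i` is semidualizing, each `C i` is
totally `C (i+1)`-reflexive, and the classes `[C i]` are pairwise distinct. -/
structure IsSemidualizingChain (R : Type u) [CommRing R] {n : ℕ}
    (C : Fin (n + 1) → ModuleCat.{u} R) : Prop where
  semidualizing : ∀ i, IsSemidualizing R (C i)
  reflexive : ∀ i : Fin n, IsTotallyReflexive R (C i.succ) (C i.castSucc)
  distinct : ∀ i j, i ≠ j → ¬ Nonempty (C i ≃ₗ[R] C j)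

/-- The sequences `1 ≤ i₁ < ⋯ < i_j ≤ n`, `j ≥ 0`, as lists. -/
def IsIndexSequence {n : ℕ} (l : List (Fin (n + 1))) : Prop :=
  l.Pairwise (· < ·) ∧ ∀ i ∈ l, 0 < i

/-- The iterated dual of `C 0`: the empty list gives `C 0`, and
`[i₁, …, i_j]` gives `Hom_R(⋯ Hom_R(Hom_R(C 0, C i₁), C i₂) ⋯, C i_j)`. -/
def iteratedDual (R : Type u) [CommRing R] {n : ℕ} (C : Fin (n + 1) → ModuleCat.{u} R)
    (l : List (Fin (n + 1))) : ModuleCat.{u} R :=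
  l.foldl (fun M i => ModuleCat.of R (M →ₗ[R] C i)) (C 0)

/-- The chain is suitable if `[C 0] = [R]` and, for every sequence `i₁ < ⋯ < i_j` and every
`t ≤ n` with `i_j ≤ t`, the iterated dual for `i₁, …, i_j` is totally `C t`-reflexive. -/
structure IsSuitableChain (R : Type u) [CommRing R] {n : ℕ}
    (C : Fin (n + 1) → ModuleCat.{u} R) : Prop extends IsSemidualizingChain R C where
  zero_iso : Nonempty (C 0 ≃ₗ[R] R)
  suitable : ∀ l : List (Fin (n + 1)), IsIndexSequence l → ∀ t : Fin (n + 1), (∀ i ∈ l, i ≤ t) →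
    IsTotallyReflexive R (C t) (iteratedDual R C l)

/-- The `R/I`-module `R/I ⊗_R M`. -/
noncomputable abbrev reduction {R : Type u} [CommRing R] (I : Ideal R) (M : ModuleCat.{u} R) :
    ModuleCat.{u} (R ⧸ I) :=
  ModuleCat.of (R ⧸ I) ((R ⧸ I) ⊗[R] M)

/-!
Write `I` for the ideal generated by the regular sequence. Everything rests on one comparison: if
`Ext^{≥ 1}_R(M, N) = 0` and the sequence is `N`-regular, then `R/I ⊗ Hom_R(M, N)` is canonically
`Hom(R/I ⊗ M, R/I ⊗ N)` over `R/I`, and if the sequence is also regular on `R` and on `M`, then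
`Ext^{≥ 1}` of the reductions vanishes over `R/I`
(`ExtVanishes.homReduction_bijective`, `ExtVanishes.reduction`).
The first half is the long exact sequence of `0 → N → N → N/rN → 0`, used one element of the
sequence at a time (`ExtVanishes.reduce_target`). The second half is dimension shifting along a free
cover of `M`, which stays exact modulo `I` (`ExtVanishes.baseChange`).

The regularity hypotheses come for free. A semidualizing `C` is faithful, and regularity descends
from `R ≅ Hom_R(C, C)` to `C` (`ExtVanishes.isWeaklyRegular_of_linearMap`); it then ascends from `C`
to every totally `C`-reflexive `M ≅ Hom_R(Hom_R(M, C), C)`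
(`ExtVanishes.isWeaklyRegular_linearMap`). Since the homothety and biduality maps of the reductions
are, up to the canonical isomorphisms, the reductions of the original ones, both notions pass to
`R/I`, and iterated duals commute with reduction by induction on the index sequence.

The classes stay distinct because in a suitable chain `C i` is totally `C j`-reflexive for all
`i ≤ j`, and for such a pair Nakayama's lemma lifts an isomorphism from `R/I`
(`IsSemidualizing.nonempty_equiv_of_reduction`).
-/

/-! ### Vanishing of Ext and extension problems -/

section Ext

variable {R : Type u} [CommRing R] {M M' N N' : Type u}
  [AddCommGroup M] [Module R M] [AddCommGroup M'] [Module R M']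
  [AddCommGroup N] [Module R N] [AddCommGroup N'] [Module R N']

lemma ExtVanishes.congr_left (e : M ≃ₗ[R] M') (h : ExtVanishes R M N) : ExtVanishes R M' N := by
  intro k hk
  have := h k hk
  refine subsingleton_of_forall_eq 0 fun y => ?_
  have h0 : (Abelian.Ext.mk₀ e.toModuleIso.hom).comp y (zero_add k) = 0 := Subsingleton.elim _ _
  rw [← Abelian.Ext.mk₀_id_comp y, ← e.toModuleIso.inv_hom_id, ← Abelian.Ext.mk₀_comp_mk₀_assoc,
    h0, Abelian.Ext.comp_zero]

lemma ExtVanishes.congr_right (e : N ≃ₗ[R] N') (h : ExtVanishes R M N) : ExtVanishes R M N' := by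
  intro k hk
  have := h k hk
  refine subsingleton_of_forall_eq 0 fun y => ?_
  have h0 : y.comp (Abelian.Ext.mk₀ e.toModuleIso.inv) (add_zero k) = 0 := Subsingleton.elim _ _
  rw [← Abelian.Ext.comp_mk₀_id y, ← e.toModuleIso.inv_hom_id, ← Abelian.Ext.mk₀_comp_mk₀,
    ← Abelian.Ext.comp_assoc_of_third_deg_zero, h0, Abelian.Ext.zero_comp]

/-- `Hom(X, S.X₂) → Hom(X, S.X₃)` is onto when `Ext^1(X, S.X₁) = 0`. -/
lemma exists_comp_eq_of_subsingleton_ext_one {S : ShortComplex (ModuleCat.{u} R)}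
    (hS : S.ShortExact) {X : ModuleCat.{u} R} [Subsingleton (Abelian.Ext X S.X₁ 1)]
    (p : X ⟶ S.X₃) : ∃ q : X ⟶ S.X₂, q ≫ S.g = p := by
  obtain ⟨y, hy⟩ := Abelian.Ext.covariant_sequence_exact₃ X hS (Abelian.Ext.mk₀ p) (zero_add 1)
    (Subsingleton.elim _ _)
  obtain ⟨q, rfl⟩ := (Abelian.Ext.mk₀_bijective _ _).2 y
  exact ⟨q, (Abelian.Ext.mk₀_bijective _ _).1 (by rw [← hy, Abelian.Ext.mk₀_comp_mk₀])⟩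

/-- `Hom(S.X₂, Y) → Hom(S.X₁, Y)` is onto when `Ext^1(S.X₃, Y) = 0`. -/
lemma exists_eq_comp_of_subsingleton_ext_one {S : ShortComplex (ModuleCat.{u} R)}
    (hS : S.ShortExact) {Y : ModuleCat.{u} R} [Subsingleton (Abelian.Ext S.X₃ Y 1)]
    (p : S.X₁ ⟶ Y) : ∃ q : S.X₂ ⟶ Y, S.f ≫ q = p := by
  obtain ⟨y, hy⟩ := Abelian.Ext.contravariant_sequence_exact₁ hS Y (Abelian.Ext.mk₀ p) (add_zero 1)
    (Subsingleton.elim _ _)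
  obtain ⟨q, rfl⟩ := (Abelian.Ext.mk₀_bijective _ _).2 y
  exact ⟨q, (Abelian.Ext.mk₀_bijective _ _).1 (by rw [← hy, Abelian.Ext.mk₀_comp_mk₀])⟩

end Ext

/-! ### Homomorphisms into a module modulo a regular sequence -/

section Hom

open RingTheory.Sequence Pointwise

variable {R : Type u} [CommRing R] {X : Type u} [AddCommGroup X] [Module R X]

lemma ExtVanishes.quotSMulTop {N : Type u} [AddCommGroup N] [Module R N] {r : R}
    (hr : IsSMulRegular N r) (h : ExtVanishes R X N) : ExtVanishes R X (QuotSMulTop r N) := by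
  intro k hk
  have hS : (ModuleCat.smulShortComplex (ModuleCat.of R N) r).ShortExact :=
    IsSMulRegular.smulShortComplex_shortExact (M := ModuleCat.of R N) hr
  have h1 := h k hk
  have h2 := h (k + 1) (by omega)
  refine subsingleton_of_forall_eq 0 fun y => ?_
  obtain ⟨z, hz⟩ := Abelian.Ext.covariant_sequence_exact₃ (ModuleCat.of R X) hS y rfl
    (h2.elim _ _)
  have hz0 : z = 0 := h1.elim z 0
  rw [← hz, hz0]
  exact Abelian.Ext.zero_comp ..

lemma ExtVanishes.exists_mkQ_comp_eq {N : Type u} [AddCommGroup N] [Module R N] {r : R}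
    (hr : IsSMulRegular N r) (h : ExtVanishes R X N) (p : X →ₗ[R] QuotSMulTop r N) :
    ∃ q : X →ₗ[R] N, (r • (⊤ : Submodule R N)).mkQ ∘ₗ q = p := by
  have hS : (ModuleCat.smulShortComplex (ModuleCat.of R N) r).ShortExact :=
    IsSMulRegular.smulShortComplex_shortExact (M := ModuleCat.of R N) hr
  have : Subsingleton (Abelian.Ext (ModuleCat.of R X)
    (ModuleCat.smulShortComplex (ModuleCat.of R N) r).X₁ 1) := h 1 le_rfl
  obtain ⟨q, hq⟩ := exists_comp_eq_of_subsingleton_ext_one hS (ModuleCat.ofHom p)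
  exact ⟨q.hom, congrArg ModuleCat.Hom.hom hq⟩

lemma mem_smul_top_of_mkQ_comp_eq_zero {N : Type u} [AddCommGroup N] [Module R N] {r : R}
    (hr : IsSMulRegular N r) (q : X →ₗ[R] N)
    (hq : (r • (⊤ : Submodule R N)).mkQ ∘ₗ q = 0) :
    q ∈ r • (⊤ : Submodule R (X →ₗ[R] N)) := by
  have hmem : ∀ y, q y ∈ LinearMap.range (LinearMap.lsmul R N r) := by
    intro y
    have := LinearMap.congr_fun hq y
    simpa [Submodule.mem_smul_pointwise_iff_exists] using this
  let e := LinearEquiv.ofInjective (LinearMap.lsmul R N r) hr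
  refine (Submodule.mem_smul_pointwise_iff_exists _ _ _).2
    ⟨e.symm.toLinearMap ∘ₗ q.codRestrict _ hmem, trivial, ?_⟩
  ext y
  have := congrArg Subtype.val (e.apply_symm_apply (q.codRestrict _ hmem y))
  exact this

/-- If `r` is `N`-regular and `Ext^1_R(X, N) = 0`, then `Hom_R(X, N)` reduces modulo `r` to
`Hom_R(X, N / r N)`. -/
noncomputable def quotSMulTopHomEquiv {N : Type u} [AddCommGroup N] [Module R N] {r : R}
    (hr : IsSMulRegular N r) (h : ExtVanishes R X N) :
    QuotSMulTop r (X →ₗ[R] N) ≃ₗ[R] (X →ₗ[R] QuotSMulTop r N) :=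
  Submodule.quotEquivOfEq _ _ (le_antisymm
      (fun q hq => by
        obtain ⟨q', -, rfl⟩ := (Submodule.mem_smul_pointwise_iff_exists _ _ _).1 hq
        ext y
        simpa using (Submodule.Quotient.mk_eq_zero (r • (⊤ : Submodule R N))).2
          (Submodule.smul_mem_pointwise_smul (q' y) r ⊤ trivial))
      (fun q hq => mem_smul_top_of_mkQ_comp_eq_zero hr q hq)) ≪≫ₗ
    (LinearMap.compRight R (M := X) (r • (⊤ : Submodule R N)).mkQ).quotKerEquivOfSurjective
      (h.exists_mkQ_comp_eq hr)

lemma IsSMulRegular.linearMap {N : Type u} [AddCommGroup N] [Module R N] {r : R}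
    (hr : IsSMulRegular N r) : IsSMulRegular (X →ₗ[R] N) r :=
  fun _ _ h => LinearMap.ext fun y => hr (LinearMap.congr_fun h y)

/-- Modulo the first element `r` of the sequence, `Hom_R(X, N)` becomes `Hom_R(X, N / r N)`, so
regularity passes from `N` to `Hom_R(X, N)` one element at a time. -/
lemma ExtVanishes.isWeaklyRegular_linearMap (xs : List R) {N : Type u} [AddCommGroup N]
    [Module R N] (hN : IsWeaklyRegular N xs) (h : ExtVanishes R X N) :
    IsWeaklyRegular (X →ₗ[R] N) xs := by
  induction xs generalizing N with
  | nil => exact .nil _ _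
  | cons r rs ih =>
    rw [isWeaklyRegular_cons_iff] at hN ⊢
    exact ⟨hN.1.linearMap, ((quotSMulTopHomEquiv hN.1 h).isWeaklyRegular_congr rs).2
      (ih hN.2 (h.quotSMulTop hN.1))⟩

/-- Reduction of the target modulo a regular sequence: for a surjection `f : N → N'` with kernel
`(xs) N`, the module `N'` inherits the vanishing of Ext, and the induced map
`Hom_R(X, N) → Hom_R(X, N')` is surjective with kernel `(xs) Hom_R(X, N)`. -/
lemma ExtVanishes.reduce_target (xs : List R) {N N' : Type u} [AddCommGroup N]
    [Module R N] [AddCommGroup N'] [Module R N'] (hN : IsWeaklyRegular N xs)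
    (h : ExtVanishes R X N) (f : N →ₗ[R] N') (hf : Function.Surjective f)
    (hker : LinearMap.ker f = Ideal.ofList xs • ⊤) :
    ExtVanishes R X N' ∧ (∀ p : X →ₗ[R] N', ∃ q : X →ₗ[R] N, f ∘ₗ q = p) ∧
      ∀ q : X →ₗ[R] N, f ∘ₗ q = 0 → q ∈ Ideal.ofList xs • (⊤ : Submodule R (X →ₗ[R] N)) := by
  induction xs generalizing N with
  | nil =>
    have hinj : Function.Injective f := by
      rw [← LinearMap.ker_eq_bot, hker, Ideal.ofList_nil, Submodule.bot_smul]
    let e := LinearEquiv.ofBijective f ⟨hinj, hf⟩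
    refine ⟨h.congr_right e, fun p => ⟨e.symm.toLinearMap ∘ₗ p, ?_⟩, fun q hq => ?_⟩
    · ext y
      exact e.apply_symm_apply (p y)
    · have : q = 0 := LinearMap.ext fun y => hinj (by simpa using LinearMap.congr_fun hq y)
      rw [this]
      exact zero_mem _
  | cons r rs ih =>
    rw [isWeaklyRegular_cons_iff] at hN
    set π := (r • (⊤ : Submodule R N)).mkQ with hπ
    have hle : r • (⊤ : Submodule R N) ≤ LinearMap.ker f := by
      rw [hker, Ideal.ofList_cons_smul]
      exact le_sup_left
    let g : QuotSMulTop r N →ₗ[R] N' := (r • (⊤ : Submodule R N)).liftQ f hle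
    have hg : g ∘ₗ π = f := Submodule.liftQ_mkQ _ _ _
    have hgs : Function.Surjective g := fun y => by
      obtain ⟨z, rfl⟩ := hf y
      exact ⟨π z, LinearMap.congr_fun hg z⟩
    have hgk : LinearMap.ker g = Ideal.ofList rs • ⊤ := by
      rw [Submodule.ker_liftQ, hker, Ideal.ofList_cons_smul, Submodule.map_sup,
        Submodule.map_smul'', Submodule.map_top, Submodule.range_mkQ, sup_eq_right,
        Submodule.map_le_iff_le_comap]
      exact le_trans (Submodule.ker_mkQ _).ge (LinearMap.ker_le_comap _)
    obtain ⟨h1, h2, h3⟩ := ih hN.2 (h.quotSMulTop hN.1) g hgs hgk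
    refine ⟨h1, fun p => ?_, fun q hq => ?_⟩
    · obtain ⟨p', rfl⟩ := h2 p
      obtain ⟨q, rfl⟩ := h.exists_mkQ_comp_eq hN.1 p'
      exact ⟨q, by rw [← LinearMap.comp_assoc, ← hπ, hg]⟩
    · have hq' := h3 (π ∘ₗ q) (by rw [← LinearMap.comp_assoc, hg, hq])
      have hsurj : Submodule.map (LinearMap.compRight R (M := X) π) ⊤ = ⊤ := by
        rw [Submodule.map_top, LinearMap.range_eq_top]
        exact h.exists_mkQ_comp_eq hN.1
      rw [← hsurj, ← Submodule.map_smul''] at hq'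
      obtain ⟨q', hq'mem, hq'eq⟩ := hq'
      have hdiff : q - q' ∈ r • (⊤ : Submodule R (X →ₗ[R] N)) := by
        apply mem_smul_top_of_mkQ_comp_eq_zero hN.1
        rw [LinearMap.comp_sub, sub_eq_zero]
        exact hq'eq.symm
      rw [Ideal.ofList_cons_smul, ← sub_add_cancel q q']
      exact Submodule.add_mem_sup hdiff hq'mem

/-- Over a Noetherian ring, regularity on `Hom_R(X, N)` descends to `N` when `X` is finite and
faithful: the support of `X` is everything, so a nonzero `r`-torsion submodule of `N` would receive
a nonzero map from `X`. -/
lemma IsSMulRegular.of_linearMap [IsNoetherianRing R] [Module.Finite R X]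
    (hX : Module.annihilator R X = ⊥) {N : Type u} [AddCommGroup N] [Module R N]
    [Module.Finite R N] {r : R} (hr : IsSMulRegular (X →ₗ[R] N) r) : IsSMulRegular N r := by
  have hsub : Subsingleton (X →ₗ[R] Submodule.torsionBy R N r) := by
    refine subsingleton_of_forall_eq 0 fun f => ?_
    have h0 : (Submodule.torsionBy R N r).subtype ∘ₗ f = 0 := by
      apply hr
      ext y
      simp
    ext y
    simpa using LinearMap.congr_fun h0 y
  obtain ⟨s, hs, hreg⟩ := IsSMulRegular.subsingleton_linearMap_iff.1 hsub
  rw [hX, Submodule.mem_bot] at hs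
  subst hs
  -- Only the zero module has `0` as a regular element.
  have := IsSMulRegular.zero_iff_subsingleton.1 hreg
  rw [isSMulRegular_iff_torsionBy_eq_bot]
  exact Submodule.eq_bot_of_subsingleton

/-- Converse of `ExtVanishes.isWeaklyRegular_linearMap` for a finite faithful `X`. -/
lemma ExtVanishes.isWeaklyRegular_of_linearMap [IsNoetherianRing R] [Module.Finite R X]
    (hX : Module.annihilator R X = ⊥) (xs : List R) {N : Type u} [AddCommGroup N] [Module R N]
    [Module.Finite R N] (h : ExtVanishes R X N) (hreg : IsWeaklyRegular (X →ₗ[R] N) xs) :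
    IsWeaklyRegular N xs := by
  induction xs generalizing N with
  | nil => exact .nil _ _
  | cons r rs ih =>
    rw [isWeaklyRegular_cons_iff] at hreg ⊢
    have hr := IsSMulRegular.of_linearMap hX hreg.1
    exact ⟨hr, ih (h.quotSMulTop hr)
      (((quotSMulTopHomEquiv hr h).isWeaklyRegular_congr rs).1 hreg.2)⟩

end Hom

/-! ### Change of rings along a regular sequence -/

section ChangeOfRings

open RingTheory.Sequence

lemma exists_one_tmul {R : Type*} [CommRing R] (I : Ideal R) {M : Type*} [AddCommGroup M]
    [Module R M] (z : (R ⧸ I) ⊗[R] M) : ∃ m, (1 : R ⧸ I) ⊗ₜ[R] m = z :=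
  TensorProduct.mk_surjective R M (R ⧸ I) Ideal.Quotient.mk_surjective z

lemma one_tmul_eq_zero_iff {R : Type*} [CommRing R] (I : Ideal R) {M : Type*} [AddCommGroup M]
    [Module R M] (m : M) : (1 : R ⧸ I) ⊗ₜ[R] m = 0 ↔ m ∈ I • (⊤ : Submodule R M) := by
  rw [← (TensorProduct.quotTensorEquivQuotSMul M I).map_eq_zero_iff,
    TensorProduct.quotTensorEquivQuotSMul_mk_one_tmul, Submodule.Quotient.mk_eq_zero]

lemma ker_mk_one {R : Type*} [CommRing R] (I : Ideal R) (M : Type*) [AddCommGroup M]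
    [Module R M] : LinearMap.ker (TensorProduct.mk R (R ⧸ I) M 1) = I • ⊤ := by
  ext m
  exact one_tmul_eq_zero_iff I m

/-- Regularity passes to the kernel: since `r` is regular on `M`, the sequence
`0 → K / r K → F / r F → M / r M → 0` is again exact. -/
lemma isWeaklyRegular_of_shortExact {R : Type*} [CommRing R] {K F M : Type*} [AddCommGroup K]
    [Module R K] [AddCommGroup F] [Module R F] [AddCommGroup M] [Module R M]
    {f : K →ₗ[R] F} {g : F →ₗ[R] M} (hf : Function.Injective f) (hfg : Function.Exact f g)
    (hg : Function.Surjective g) (xs : List R) (hF : IsWeaklyRegular F xs)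
    (hM : IsWeaklyRegular M xs) : IsWeaklyRegular K xs := by
  induction xs generalizing K F M with
  | nil => exact .nil _ _
  | cons r rs ih =>
    rw [isWeaklyRegular_cons_iff] at hF hM ⊢
    refine ⟨hF.1.of_injective f hf, ih (f := QuotSMulTop.map r f) (g := QuotSMulTop.map r g) ?_
      (QuotSMulTop.map_exact r hfg hg) (QuotSMulTop.map_surjective r hg) hF.2 hM.2⟩
    have h0 : Function.Exact (0 : PUnit →ₗ[R] K) f := by
      rw [LinearMap.exact_iff, LinearMap.ker_eq_bot.2 hf, LinearMap.range_zero]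
    have := QuotSMulTop.map_first_exact_on_four_term_exact_of_isSMulRegular_last h0 hfg hM.1
    rw [LinearMap.exact_iff, map_zero, LinearMap.range_zero] at this
    exact LinearMap.ker_eq_bot.1 this

/-- A regular sequence on `M` is `Tor`-independent of `M`: reduction keeps a short exact sequence
`0 → K → F → M → 0` exact on the left. -/
lemma baseChange_injective_of_isWeaklyRegular {R : Type*} [CommRing R] {K F M : Type*}
    [AddCommGroup K] [Module R K] [AddCommGroup F] [Module R F] [AddCommGroup M] [Module R M]
    {f : K →ₗ[R] F} {g : F →ₗ[R] M} (hf : Function.Injective f) (hfg : Function.Exact f g)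
    (hg : Function.Surjective g) (xs : List R) (hM : IsWeaklyRegular M xs) :
    Function.Injective (f.baseChange (R ⧸ Ideal.ofList xs)) := by
  have h0 : Function.Exact (0 : PUnit →ₗ[R] K) f := by
    rw [LinearMap.exact_iff, LinearMap.ker_eq_bot.2 hf, LinearMap.range_zero]
  have := map_first_exact_on_four_term_right_exact_of_isSMulRegular_last h0 hfg hg hM
  rw [injective_iff_map_eq_zero]
  intro z hz
  obtain ⟨k, rfl⟩ := exists_one_tmul _ z
  rw [LinearMap.baseChange_tmul, one_tmul_eq_zero_iff] at hz
  obtain ⟨y, hy⟩ := (this (Submodule.Quotient.mk k)).1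
    ((Submodule.Quotient.mk_eq_zero _).2 hz)
  obtain ⟨y, rfl⟩ := Submodule.Quotient.mk_surjective _ y
  rw [one_tmul_eq_zero_iff, ← Submodule.Quotient.mk_eq_zero, ← hy]
  rfl

lemma isWeaklyRegular_of_flat {R : Type*} [CommRing R] (F : Type*) [AddCommGroup F] [Module R F]
    [Module.Flat R F] {xs : List R} (h : IsWeaklyRegular R xs) : IsWeaklyRegular F xs :=
  ((TensorProduct.rid R F).isWeaklyRegular_congr xs).1 h.isWeaklyRegular_lTensor

lemma exists_free_cover (R : Type u) [CommRing R] (M : Type u) [AddCommGroup M] [Module R M] :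
    ∃ (K F : Type u) (_ : AddCommGroup K) (_ : Module R K) (_ : AddCommGroup F) (_ : Module R F)
      (f : K →ₗ[R] F) (g : F →ₗ[R] M), Module.Free R F ∧
      Function.Injective f ∧ Function.Exact f g ∧ Function.Surjective g :=
  let S := (ModuleCat.of R M).projectiveShortComplex
  have hS := (ModuleCat.of R M).shortExact_projectiveShortComplex
  ⟨S.X₁, S.X₂, inferInstance, inferInstance, inferInstance, inferInstance, S.f.hom, S.g.hom,
    inferInstance, hS.moduleCat_injective_f,
    (ShortComplex.ShortExact.moduleCat_exact_iff_function_exact _).1 hS.exact,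
    hS.moduleCat_surjective_g⟩

/-- Change of rings for Ext-vanishing: if `xs` is regular on `R` and on `M`, and `Y` is a module
over `R / (xs)`, then `Ext^{≥ 1}_R(M, Y) = 0` gives `Ext^{≥ 1}` vanishing of `M / (xs) M` into `Y`
over `R / (xs)`. This is dimension shifting along a free cover of `M`, whose reduction is a free
cover of the reduction of `M`. -/
lemma ExtVanishes.baseChange {R : Type u} [CommRing R] {xs : List R} (hR : IsWeaklyRegular R xs)
    {Y : Type u} [AddCommGroup Y] [Module R Y] [Module (R ⧸ Ideal.ofList xs) Y]
    [IsScalarTower R (R ⧸ Ideal.ofList xs) Y] {M : Type u} [AddCommGroup M] [Module R M]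
    (hM : IsWeaklyRegular M xs) (h : ExtVanishes R M Y) :
    ExtVanishes (R ⧸ Ideal.ofList xs) ((R ⧸ Ideal.ofList xs) ⊗[R] M) Y := by
  intro k hk
  induction k using Nat.strong_induction_on generalizing M with
  | _ k ih
  obtain ⟨k, rfl⟩ : ∃ j, k = j + 1 := ⟨k - 1, by omega⟩
  let S := R ⧸ Ideal.ofList xs
  obtain ⟨K, F, _, _, _, _, f, g, hF, hf, hfg, hg⟩ := exists_free_cover R M
  have hK : IsWeaklyRegular K xs :=
    isWeaklyRegular_of_shortExact hf hfg hg xs (isWeaklyRegular_of_flat F hR) hM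
  let T := ModuleCat.shortComplexOfCompEqZero f g hfg.linearMap_comp_eq_zero
  have hT : T.ShortExact := ModuleCat.shortComplex_shortExact T hfg hf hg
  have hfg' : Function.Exact (f.baseChange S) (g.baseChange S) := lTensor_exact S hfg hg
  let T' := ModuleCat.shortComplexOfCompEqZero (f.baseChange S) (g.baseChange S)
    hfg'.linearMap_comp_eq_zero
  have hT' : T'.ShortExact := ModuleCat.shortComplex_shortExact T' hfg'
    (baseChange_injective_of_isWeaklyRegular hf hfg hg xs hM) (LinearMap.lTensor_surjective S hg)
  have hP : Projective T.X₂ := (IsProjective.iff_projective F).1 inferInstance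
  have hP' : Projective T'.X₂ := (IsProjective.iff_projective (S ⊗[R] F)).1 inferInstance
  -- The middle term is projective, so each class is the connecting image of a class on the kernel.
  refine subsingleton_of_forall_eq 0 fun y => ?_
  obtain ⟨z, rfl⟩ := precomp_extClass_surjective_of_projective_X₂ (ModuleCat.of S Y) hT' k y
  rcases k with - | k
  · -- A map from the reduced kernel into `Y` is an `R`-linear map from `K`, which extends to `F`
    -- because `Ext^1_R(M, Y) = 0`; its connecting image therefore vanishes.
    obtain ⟨p, rfl⟩ := (Abelian.Ext.mk₀_bijective _ _).2 z
    have : Subsingleton (Abelian.Ext T.X₃ (ModuleCat.of R Y) 1) := h 1 le_rfl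
    obtain ⟨q, hq⟩ := exists_eq_comp_of_subsingleton_ext_one hT (Y := ModuleCat.of R Y)
      (ModuleCat.ofHom ((LinearMap.liftBaseChangeEquiv S).symm p.hom))
    have hq' : p = T'.f ≫ ModuleCat.ofHom (q.hom.liftBaseChange S) := by
      refine ModuleCat.hom_ext (LinearMap.ext fun x => ?_)
      obtain ⟨x, rfl⟩ := exists_one_tmul _ x
      have h1 : q.hom (f x) = p.hom (1 ⊗ₜ x) :=
        LinearMap.congr_fun (congrArg ModuleCat.Hom.hom hq) x
      change p.hom (1 ⊗ₜ x) = q.hom.liftBaseChange S (f.baseChange S (1 ⊗ₜ x))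
      rw [LinearMap.baseChange_tmul, LinearMap.liftBaseChange_one_tmul, h1]
    rw [hq', ← Abelian.Ext.mk₀_comp_mk₀]
    exact hT'.extClass_comp_assoc _ (h := add_comm 1 0)
  · have hKY : ExtVanishes R K Y := fun m hm => by
      refine subsingleton_of_forall_eq 0 fun w => ?_
      obtain ⟨v, hv⟩ := Abelian.Ext.contravariant_sequence_exact₁ hT (ModuleCat.of R Y) w rfl
        ((h (1 + m) (by omega)).elim _ _)
      obtain ⟨m, rfl⟩ : ∃ j, m = j + 1 := ⟨m - 1, by omega⟩
      rw [← hv, Abelian.Ext.eq_zero_of_projective v]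
      exact Abelian.Ext.comp_zero ..
    have hz : z = 0 := (ih (k + 1) (by omega) hK hKY (by omega)).elim _ _
    rw [hz, map_zero]

end ChangeOfRings

/-! ### Reduction of Hom, of semidualizing modules and of total reflexivity -/

section Reduction

open RingTheory.Sequence

/-- The canonical map `R/I ⊗ Hom_R(M, N) → Hom_{R/I}(R/I ⊗ M, R/I ⊗ N)`. -/
noncomputable def homReduction {R : Type*} [CommRing R] (I : Ideal R) (M N : Type*)
    [AddCommGroup M] [Module R M] [AddCommGroup N] [Module R N] :
    (R ⧸ I) ⊗[R] (M →ₗ[R] N) →ₗ[R ⧸ I] ((R ⧸ I) ⊗[R] M →ₗ[R ⧸ I] (R ⧸ I) ⊗[R] N) :=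
  (LinearMap.baseChangeHom R (R ⧸ I) M N).liftBaseChange (R ⧸ I)

lemma homReduction_one_tmul {R : Type*} [CommRing R] (I : Ideal R) {M N : Type*}
    [AddCommGroup M] [Module R M] [AddCommGroup N] [Module R N] (q : M →ₗ[R] N) :
    homReduction I M N (1 ⊗ₜ q) = q.baseChange (R ⧸ I) :=
  LinearMap.liftBaseChange_one_tmul ..

variable {R : Type u} [CommRing R] {M N C : Type u} [AddCommGroup M] [Module R M]
  [AddCommGroup N] [Module R N] [AddCommGroup C] [Module R C] {xs : List R}

/-- Both sides are `Hom_R(M, N / (xs) N)`: the left one by `ExtVanishes.reduce_target`, the right one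
by the adjunction between base change and restriction of scalars. -/
lemma ExtVanishes.homReduction_bijective (h : ExtVanishes R M N) (hN : IsWeaklyRegular N xs) :
    Function.Bijective (homReduction (Ideal.ofList xs) M N) := by
  obtain ⟨-, hlift, hker⟩ := h.reduce_target xs hN
    (TensorProduct.mk R (R ⧸ Ideal.ofList xs) N 1) (exists_one_tmul _) (ker_mk_one _ _)
  constructor
  · rw [injective_iff_map_eq_zero]
    intro z hz
    obtain ⟨q, rfl⟩ := exists_one_tmul _ z
    rw [homReduction_one_tmul] at hz
    rw [one_tmul_eq_zero_iff]
    refine hker q (LinearMap.ext fun m => ?_)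
    simpa using LinearMap.congr_fun hz (1 ⊗ₜ m)
  · intro p
    obtain ⟨q, hq⟩ := hlift ((LinearMap.liftBaseChangeEquiv _).symm p)
    refine ⟨1 ⊗ₜ q, LinearMap.ext fun z => ?_⟩
    obtain ⟨m, rfl⟩ := exists_one_tmul _ z
    rw [homReduction_one_tmul, LinearMap.baseChange_tmul]
    exact LinearMap.congr_fun hq m

/-- Vanishing of `Ext^{≥ 1}` is preserved by reduction modulo a sequence regular on the ring and on
both modules. -/
lemma ExtVanishes.reduction (h : ExtVanishes R M N) (hR : IsWeaklyRegular R xs)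
    (hM : IsWeaklyRegular M xs) (hN : IsWeaklyRegular N xs) :
    ExtVanishes (R ⧸ Ideal.ofList xs) ((R ⧸ Ideal.ofList xs) ⊗[R] M)
      ((R ⧸ Ideal.ofList xs) ⊗[R] N) :=
  .baseChange hR hM (h.reduce_target xs hN
    (TensorProduct.mk R (R ⧸ Ideal.ofList xs) N 1) (exists_one_tmul _) (ker_mk_one _ _)).1

lemma IsSemidualizing.annihilator_eq_bot (hC : IsSemidualizing R C) :
    Module.annihilator R C = ⊥ := by
  rw [eq_bot_iff]
  intro r hr
  refine hC.homothety.1 (LinearMap.ext fun c => ?_)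
  simpa using Module.mem_annihilator.1 hr c

/-- A sequence regular on `R ≅ Hom_R(C, C)` is regular on `C`. -/
lemma IsSemidualizing.isWeaklyRegular [IsNoetherianRing R] (hC : IsSemidualizing R C)
    (hR : IsWeaklyRegular R xs) : IsWeaklyRegular C xs :=
  have := hC.finite
  hC.ext_self.isWeaklyRegular_of_linearMap hC.annihilator_eq_bot xs
    (((LinearEquiv.ofBijective _ hC.homothety).isWeaklyRegular_congr xs).1 hR)

lemma IsSemidualizing.reduction [IsNoetherianRing R] (hC : IsSemidualizing R C)
    (hR : IsWeaklyRegular R xs) :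
    IsSemidualizing (R ⧸ Ideal.ofList xs) ((R ⧸ Ideal.ofList xs) ⊗[R] C) where
  finite := have := hC.finite; inferInstance
  homothety := by
    let S := R ⧸ Ideal.ofList xs
    have hCx := hC.isWeaklyRegular hR
    let e := (LinearEquiv.ofBijective (LinearMap.lsmul R C) hC.homothety).baseChange
      R S R (C →ₗ[R] C)
    have h : ⇑(LinearMap.lsmul (R := S) (M := S ⊗[R] C)) = homReduction (Ideal.ofList xs) C C ∘ e ∘
        (TensorProduct.AlgebraTensorModule.rid R S S).symm := by
      funext s
      obtain ⟨r, rfl⟩ := Ideal.Quotient.mk_surjective s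
      have h1 : (TensorProduct.AlgebraTensorModule.rid R S S).symm (Ideal.Quotient.mk _ r) =
          1 ⊗ₜ r := by
        rw [LinearEquiv.symm_apply_eq, TensorProduct.AlgebraTensorModule.rid_tmul,
          ← Ideal.Quotient.algebraMap_eq, Algebra.algebraMap_eq_smul_one]
      refine LinearMap.ext fun z => ?_
      obtain ⟨c, rfl⟩ := exists_one_tmul _ z
      rw [Function.comp_apply, Function.comp_apply, h1, LinearEquiv.baseChange_tmul,
        homReduction_one_tmul, LinearMap.baseChange_tmul]
      change Ideal.Quotient.mk (Ideal.ofList xs) r • ((1 : S) ⊗ₜ[R] c) = (1 : S) ⊗ₜ[R] (r • c)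
      rw [TensorProduct.tmul_smul, ← Ideal.Quotient.algebraMap_eq, algebraMap_smul]
    rw [h]
    exact (hC.ext_self.homReduction_bijective hCx).comp (e.bijective.comp (LinearEquiv.bijective _))
  ext_self := hC.ext_self.reduction hR (hC.isWeaklyRegular hR) (hC.isWeaklyRegular hR)

/-- A sequence regular on `C` is regular on `M ≅ Hom_R(Hom_R(M, C), C)`. -/
lemma IsTotallyReflexive.isWeaklyRegular (hM : IsTotallyReflexive R C M)
    (hC : IsWeaklyRegular C xs) : IsWeaklyRegular M xs :=
  ((LinearEquiv.ofBijective _ hM.biduality).isWeaklyRegular_congr xs).2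
    (hM.ext_dual.isWeaklyRegular_linearMap xs hC)

/-- Under the isomorphism `R/I ⊗ Hom_R(M, C) ≅ Hom(R/I ⊗ M, R/I ⊗ C)` and the analogous one for the
bidual, the biduality map of the reduction is the reduction of the biduality map. -/
lemma IsTotallyReflexive.reduction (hM : IsTotallyReflexive R C M) (hR : IsWeaklyRegular R xs)
    (hC : IsWeaklyRegular C xs) :
    IsTotallyReflexive (R ⧸ Ideal.ofList xs) ((R ⧸ Ideal.ofList xs) ⊗[R] C)
      ((R ⧸ Ideal.ofList xs) ⊗[R] M) := by
  let S := R ⧸ Ideal.ofList xs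
  let φ := LinearEquiv.ofBijective _ (hM.ext.homReduction_bijective hC)
  refine ⟨have := hM.finite; inferInstance, ?_, hM.ext.reduction hR (hM.isWeaklyRegular hC) hC,
    (hM.ext_dual.reduction hR (hM.ext.isWeaklyRegular_linearMap xs hC) hC).congr_left φ⟩
  let β := (LinearEquiv.ofBijective _ hM.biduality).baseChange R S M ((M →ₗ[R] C) →ₗ[R] C)
  have h : (fun p : (S ⊗[R] M →ₗ[S] S ⊗[R] C) →ₗ[S] S ⊗[R] C => p ∘ₗ φ.toLinearMap) ∘
      (LinearMap.applyₗ : S ⊗[R] M →ₗ[S] (S ⊗[R] M →ₗ[S] S ⊗[R] C) →ₗ[S] S ⊗[R] C) =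
      homReduction (Ideal.ofList xs) (M →ₗ[R] C) C ∘ β := by
    funext z
    refine LinearMap.ext fun w => ?_
    obtain ⟨m, rfl⟩ := exists_one_tmul _ z
    obtain ⟨q, rfl⟩ := exists_one_tmul _ w
    rw [Function.comp_apply, Function.comp_apply, LinearEquiv.baseChange_tmul,
      homReduction_one_tmul, LinearMap.baseChange_tmul]
    change homReduction (Ideal.ofList xs) M C (1 ⊗ₜ q) (1 ⊗ₜ m) = (1 : S) ⊗ₜ[R] q m
    rw [homReduction_one_tmul, LinearMap.baseChange_tmul]
  refine (Function.Bijective.of_comp_iff' (f := fun p => p ∘ₗ φ.toLinearMap)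
    ⟨fun p q hpq => ?_, fun p => ⟨p ∘ₗ φ.symm.toLinearMap, ?_⟩⟩ _).1 ?_
  · ext1 y
    obtain ⟨y, rfl⟩ := φ.surjective y
    exact LinearMap.congr_fun hpq y
  · exact LinearMap.ext fun y => congrArg p (φ.symm_apply_apply y)
  · rw [h]
    exact (hM.ext_dual.homReduction_bijective hC).comp β.bijective

lemma IsTotallyReflexive.congr {M' : Type u} [AddCommGroup M'] [Module R M'] (e : M ≃ₗ[R] M')
    (hM : IsTotallyReflexive R C M) : IsTotallyReflexive R C M' := by
  let φ : (M →ₗ[R] C) ≃ₗ[R] (M' →ₗ[R] C) := e.congrLeft C R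
  let ψ : ((M →ₗ[R] C) →ₗ[R] C) ≃ₗ[R] ((M' →ₗ[R] C) →ₗ[R] C) := φ.congrLeft C R
  refine ⟨have := hM.finite; .equiv e, ?_, hM.ext.congr_left e, hM.ext_dual.congr_left φ⟩
  have h : ⇑(LinearMap.applyₗ : M' →ₗ[R] (M' →ₗ[R] C) →ₗ[R] C) =
      ψ ∘ (LinearMap.applyₗ : M →ₗ[R] (M →ₗ[R] C) →ₗ[R] C) ∘ e.symm := by
    funext m
    refine LinearMap.ext fun q => ?_
    change q m = q (e (e.symm m))
    rw [e.apply_symm_apply]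
  rw [h]
  exact ψ.bijective.comp (hM.biduality.comp e.symm.bijective)

/-- Reduction detects isomorphism of a semidualizing module `B` with a module `C` for which it is
totally reflexive: an isomorphism modulo `xs` makes `Hom_R(B, C)` cyclic by Nakayama, say `R/a`;
since `B ≅ Hom_R(R/a, C)` is faithful, `a = 0`, whence `B ≅ Hom_R(R, C) ≅ C`. -/
lemma IsSemidualizing.nonempty_equiv_of_reduction [IsLocalRing R] [IsNoetherianRing R]
    {B : Type u} [AddCommGroup B] [Module R B] (hB : IsSemidualizing R B)
    (hC : IsSemidualizing R C) (hBC : IsTotallyReflexive R C B) (hR : IsRegular R xs)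
    (e : (R ⧸ Ideal.ofList xs) ⊗[R] B ≃ₗ[R ⧸ Ideal.ofList xs] (R ⧸ Ideal.ofList xs) ⊗[R] C) :
    Nonempty (B ≃ₗ[R] C) := by
  let S := R ⧸ Ideal.ofList xs
  have hCx := hC.isWeaklyRegular hR.1
  have := hB.finite
  have := hC.finite
  have hI : Ideal.ofList xs ≤ Ideal.jacobson ⊥ := by
    rw [IsLocalRing.jacobson_eq_maximalIdeal ⊥ bot_ne_top]
    refine IsLocalRing.le_maximalIdeal fun h => hR.2 ?_
    rw [h, Submodule.top_smul]
  let φ := LinearEquiv.ofBijective _ (hBC.ext.homReduction_bijective hCx)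
  let θ := LinearEquiv.ofBijective _ (hC.reduction hR.1).homothety
  -- The class of `1` under `R/I ≅ Hom(C/IC, C/IC) ≅ Hom(B/IB, C/IC) ≅ Hom_R(B, C) / I`.
  let ε : S ≃ₗ[S] S ⊗[R] (B →ₗ[R] C) := θ ≪≫ₗ e.symm.congrLeft _ S ≪≫ₗ φ.symm
  obtain ⟨q, hq⟩ := exists_one_tmul _ (ε 1)
  have hspan : (R ∙ q) = ⊤ := by
    rw [eq_top_iff]
    refine Submodule.le_of_le_smul_of_le_jacobson_bot Module.Finite.fg_top hI fun p _ => ?_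
    obtain ⟨s, hs⟩ := ε.surjective (1 ⊗ₜ p)
    obtain ⟨r, rfl⟩ := Ideal.Quotient.mk_surjective s
    have h1 : (1 : S) ⊗ₜ[R] (p - r • q) = 0 := by
      rw [TensorProduct.tmul_sub, TensorProduct.tmul_smul, hq, ← hs, sub_eq_zero,
        ← algebraMap_smul S r (ε 1), ← map_smul, smul_eq_mul, mul_one]
      rfl
    rw [one_tmul_eq_zero_iff] at h1
    rw [← add_sub_cancel (r • q) p]
    exact Submodule.add_mem_sup (Submodule.smul_mem _ _ (Submodule.mem_span_singleton_self q)) h1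
  have hinj : Function.Injective (LinearMap.toSpanSingleton R (B →ₗ[R] C) q) := by
    rw [injective_iff_map_eq_zero]
    intro r hr
    rw [LinearMap.toSpanSingleton_apply] at hr
    rw [← Submodule.mem_bot R, ← hB.annihilator_eq_bot, Module.mem_annihilator]
    intro b
    refine hBC.biduality.1 (LinearMap.ext fun p => ?_)
    obtain ⟨s, rfl⟩ := Submodule.mem_span_singleton.1 (hspan ▸ Submodule.mem_top : p ∈ R ∙ q)
    simp only [LinearMap.applyₗ_apply_apply, map_zero, LinearMap.zero_apply]
    rw [map_smul, LinearMap.smul_apply, smul_comm, ← LinearMap.smul_apply r, hr,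
      LinearMap.zero_apply, smul_zero]
  let η : R ≃ₗ[R] (B →ₗ[R] C) := LinearEquiv.ofBijective (LinearMap.toSpanSingleton R _ q)
    ⟨hinj, by rw [← LinearMap.range_eq_top, LinearMap.range_toSpanSingleton, hspan]⟩
  exact ⟨LinearEquiv.ofBijective _ hBC.biduality ≪≫ₗ η.symm.congrLeft C R ≪≫ₗ
    LinearMap.ringLmapEquivSelf R R C⟩

end Reduction

/-! ### Suitable chains -/

section SuitableChain

lemma iteratedDual_append_singleton (R : Type u) [CommRing R] {n : ℕ}
    (C : Fin (n + 1) → ModuleCat.{u} R) (l : List (Fin (n + 1))) (i : Fin (n + 1)) :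
    iteratedDual R C (l ++ [i]) = ModuleCat.of R (iteratedDual R C l →ₗ[R] C i) :=
  List.foldl_append ..

variable {R : Type u} [CommRing R] {n : ℕ} {C : Fin (n + 1) → ModuleCat.{u} R}

lemma IsIndexSequence.of_append_singleton {l : List (Fin (n + 1))} {i : Fin (n + 1)}
    (h : IsIndexSequence (l ++ [i])) : IsIndexSequence l ∧ ∀ j ∈ l, j ≤ i := by
  obtain ⟨h1, h2⟩ := h
  rw [List.pairwise_append] at h1
  exact ⟨⟨h1.1, fun j hj => h2 j (List.mem_append_left _ hj)⟩,
    fun j hj => (h1.2.2 j hj i (List.mem_singleton_self i)).le⟩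

/-- In a suitable chain `C i` is totally `C j`-reflexive for all `i ≤ j`, because `C i` is the
iterated dual of `C 0 ≅ R` for the sequence `[i]`. -/
lemma IsSuitableChain.isTotallyReflexive_of_le (hC : IsSuitableChain R C) {i j : Fin (n + 1)}
    (hij : i ≤ j) : IsTotallyReflexive R (C j) (C i) := by
  rcases eq_or_ne i 0 with rfl | hi
  · exact hC.suitable [] ⟨List.Pairwise.nil, by simp⟩ j (by simp)
  · obtain ⟨e⟩ := hC.zero_iso
    exact (hC.suitable [i] ⟨List.pairwise_singleton _ _, by simpa using Fin.pos_of_ne_zero hi⟩ j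
      (by simpa using hij)).congr (e.congrLeft (C i) R ≪≫ₗ LinearMap.ringLmapEquivSelf R R (C i))

lemma IsSuitableChain.nonempty_iteratedDual_equiv {xs : List R} [IsNoetherianRing R]
    (hC : IsSuitableChain R C) (hR : RingTheory.Sequence.IsWeaklyRegular R xs)
    (l : List (Fin (n + 1))) (hl : IsIndexSequence l) :
    Nonempty (iteratedDual (R ⧸ Ideal.ofList xs) (fun i => reduction (Ideal.ofList xs) (C i)) l
        ≃ₗ[R ⧸ Ideal.ofList xs] reduction (Ideal.ofList xs) (iteratedDual R C l)) := by
  induction l using List.reverseRecOn with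
  | nil => exact ⟨LinearEquiv.refl _ _⟩
  | append_singleton l i ih =>
    obtain ⟨hl', hi⟩ := hl.of_append_singleton
    obtain ⟨e⟩ := ih hl'
    rw [iteratedDual_append_singleton, iteratedDual_append_singleton]
    exact ⟨e.congrLeft _ (R ⧸ Ideal.ofList xs) ≪≫ₗ
      (LinearEquiv.ofBijective _ ((hC.suitable l hl' i hi).ext.homReduction_bijective
        ((hC.semidualizing i).isWeaklyRegular hR))).symm⟩

end SuitableChain

theorem proposition3p1 (R : Type u) [CommRing R] [IsLocalRing R] [IsNoetherianRing R]
    (x : List R) (hx : RingTheory.Sequence.IsRegular R x)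
    (n : ℕ) (C : Fin (n + 1) → ModuleCat.{u} R) (hC : IsSuitableChain R C) :
    IsSuitableChain (R ⧸ Ideal.ofList x) (fun i => reduction (Ideal.ofList x) (C i)) ∧
    ∀ l : List (Fin (n + 1)), IsIndexSequence l →
      Nonempty (iteratedDual (R ⧸ Ideal.ofList x) (fun i => reduction (Ideal.ofList x) (C i)) l
        ≃ₗ[R ⧸ Ideal.ofList x] reduction (Ideal.ofList x) (iteratedDual R C l)) := by
  have hCx i := (hC.semidualizing i).isWeaklyRegular hx.1
  have hdual := hC.nonempty_iteratedDual_equiv hx.1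
  have hlt : ∀ i j, i < j → ¬ Nonempty (reduction (Ideal.ofList x) (C i)
      ≃ₗ[R ⧸ Ideal.ofList x] reduction (Ideal.ofList x) (C j)) := fun i j hij ⟨e⟩ =>
    hC.distinct i j hij.ne ((hC.semidualizing i).nonempty_equiv_of_reduction (hC.semidualizing j)
      (hC.isTotallyReflexive_of_le hij.le) hx e)
  refine ⟨⟨⟨fun i => (hC.semidualizing i).reduction hx.1,
    fun i => (hC.reflexive i).reduction hx.1 (hCx _), fun i j hij => ?_⟩, ?_, ?_⟩, hdual⟩
  · rcases hij.lt_or_gt with h | h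
    · exact hlt i j h
    · exact fun ⟨e⟩ => hlt j i h ⟨e.symm⟩
  · obtain ⟨e⟩ := hC.zero_iso
    exact ⟨e.baseChange R (R ⧸ Ideal.ofList x) (C 0) R ≪≫ₗ
      TensorProduct.AlgebraTensorModule.rid R (R ⧸ Ideal.ofList x) (R ⧸ Ideal.ofList x)⟩
  · intro l hl t ht
    obtain ⟨e⟩ := hdual l hl
    exact ((hC.suitable l hl t ht).reduction hx.1 (hCx t)).congr e.symm
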